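/- Let $k$ be a field of characteristic $0$, let $S=k[x,y,z]$ and $\mathfrak m=(x,y,z)$. For an ideal $I\subseteq S$ with $\dim_k(S/I)<\infty$ let $T(I)=\operatorname{Hom}_S(I,S/I)$, the tangent space at $[I]$ to the Hilbert scheme of points of $\mathbf A^3$; it is a finite-dimensional $k$-vector space. Let $d,r,p$ be natural numbers and let $I\subseteq S$ be an ideal with $\dim_k(S/I)=d\le\binom{r+2}{3}$. Suppose that $I$ is Borel-fixed, that is, mapped onto itself by every $k$-algebra automorphism of $S$ given by $x_j\mapsto\sum_{i\le j}g_{ij}x_i$, where $(x_1,x_2,x_3)=(x,y,z)$ and $g=(g_{ij})$ is an invertible upper triangular $3\times3$ matrix over $k$. If $x^p\in I$ and $p\le\frac{3r+1}{4}$, then $$\dim_k T(I)\le\dim_k T(\mathfrak m^r).$$ (In particular, for $d=\binom{r+2}{3}$ this is the inequality $\dim_kT(I)\le\dim_kT(\mathfrak m^r)$ conjectured by Briançon and Iarrobino for all ideals of colength $d$.) -/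

import Mathlib

noncomputable section

namespace HilbPoints

/-- The linear change of coordinates of `k[x_1, …, x_n]` given by an invertible matrix `g`:
the `k`-algebra endomorphism with `x_j ↦ ∑ i, g i j * x_i`
(the usual action of `GL_n` on the span of the variables, with the variables as basis). -/
def coordChange {K : Type*} [Field K] {n : ℕ} (g : GL (Fin n) K) :
    MvPolynomial (Fin n) K →ₐ[K] MvPolynomial (Fin n) K :=
  MvPolynomial.aeval fun j => ∑ i, MvPolynomial.C ((g : Matrix (Fin n) (Fin n) K) i j) *
    MvPolynomial.X i

theorem coordChange_comp {K : Type*} [Field K] {n : ℕ} (g h : GL (Fin n) K) :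
    (coordChange g).comp (coordChange h) = coordChange (g * h) := by
  refine MvPolynomial.algHom_ext fun j => ?_
  simp only [coordChange, AlgHom.comp_apply, MvPolynomial.aeval_X, map_sum, map_mul,
    MvPolynomial.aeval_C, MvPolynomial.algebraMap_eq, Units.val_mul, Matrix.mul_apply,
    Finset.mul_sum, Finset.sum_mul]
  rw [Finset.sum_comm]
  refine Finset.sum_congr rfl fun k _ => Finset.sum_congr rfl fun i _ => ?_
  ring

theorem coordChange_one {K : Type*} [Field K] {n : ℕ} :
    coordChange (1 : GL (Fin n) K) = AlgHom.id K (MvPolynomial (Fin n) K) := by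
  refine MvPolynomial.algHom_ext fun j => ?_
  simp [coordChange, Matrix.one_apply, Finset.sum_ite_eq']

/-- `I` is Borel-fixed: `g(I) = I` for every invertible upper triangular matrix `g`.
As `coordChange g` is bijective, `Ideal.map` is here just the image of `I`. -/
def IsBorelFixed {K : Type*} [Field K] {n : ℕ} (I : Ideal (MvPolynomial (Fin n) K)) : Prop :=
  ∀ g : GL (Fin n) K, (g : Matrix (Fin n) (Fin n) K).BlockTriangular id →
    I.map (coordChange g) = I

/-- `[I]` is a `k`-point of the Hilbert scheme `Hilb^d 𝔸^n`: `dim_k (S / I) = d`, finite. -/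
def IsHilbPoint {K : Type*} [Field K] {n : ℕ} (d : ℕ) (I : Ideal (MvPolynomial (Fin n) K)) :
    Prop :=
  Module.Finite K (MvPolynomial (Fin n) K ⧸ I) ∧
    Module.finrank K (MvPolynomial (Fin n) K ⧸ I) = d

/-- The tangent space `T(I) = Hom_S(I, S / I)`, a `k`-vector space. -/
abbrev TangentSpace {K : Type*} [Field K] {n : ℕ} (I : Ideal (MvPolynomial (Fin n) K)) : Type _ :=
  I →ₗ[MvPolynomial (Fin n) K] (MvPolynomial (Fin n) K ⧸ I)

/-- The ideal `𝔪 = (x_1, …, x_n)` of the origin. -/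
def originIdeal (K : Type*) [Field K] (n : ℕ) : Ideal (MvPolynomial (Fin n) K) :=
  Ideal.span (Set.range MvPolynomial.X)

end HilbPoints

end

/-! Two bounds meet: `dim T(I) ≤ (2p+1)d` for a monomial ideal containing `x^p`, and `dim T(𝔪^r) ≥
C(r+2,2) C(r+1,2)`. As `d ≤ C(r+2,3)`, the hypothesis `4p ≤ 3r+1` is exactly what compares them.

Upper bound (`finrank_tangentSpace_le`): `I` is generated by `x^p` and the monomials `x^i y^j
z^{c_ij}` with `i < p`. The value of a tangent vector on `x^p` costs `d`. For fixed `i`, its values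
`n_j ∈ M = S/I` satisfy `y n_j = z^{c_ij - c_i(j+1)} n_{j+1}`, so they lie in the kernel of a map
`M^{a+1} → M^a`, of dimension `d` plus that of the cokernel. Trading `y` for powers of `z` shows
that the cokernel has dimension at most `p ∑_j c_ij`, because `1, x, …, x^{p-1}` generate `M` over
`k[y,z]`. Summing over `i`, where `∑ c_ij ≤ d`, gives `d + pd + pd`.

Lower bound: any linear map from forms of degree `r` to forms of degree `r-1` defines a tangent
vector at `𝔪^r`.

Of Borel-fixedness only invariance under one diagonal matrix is needed; it makes `I` monomial. -/

/-! ### The kernel of a staircase operator -/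

/-- The operator `(n_j) ↦ (Y n_j - Z ^ (c_j - c_{j+1}) n_{j+1})` attached to a staircase `c`. -/
noncomputable def staircaseMap {K M : Type*} [Field K] [AddCommGroup M] [Module K M]
    (Y Z : Module.End K M) (c : ℕ → ℕ) (a : ℕ) : (Fin (a + 1) → M) →ₗ[K] (Fin a → M) :=
  LinearMap.pi fun j => Y ∘ₗ LinearMap.proj j.castSucc
    - (Z ^ (c j - c (j + 1))) ∘ₗ LinearMap.proj j.succ

theorem staircaseMap_apply {K M : Type*} [Field K] [AddCommGroup M] [Module K M]
    (Y Z : Module.End K M) (c : ℕ → ℕ) (a : ℕ) (n : Fin (a + 1) → M) (j : Fin a) :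
    staircaseMap Y Z c a n j = Y (n j.castSucc) - (Z ^ (c j - c (j + 1))) (n j.succ) := rfl

/-- The class of `w`, placed at index `j`, in the cokernel of `staircaseMap`. -/
noncomputable def staircaseClass {K M : Type*} [Field K] [AddCommGroup M] [Module K M]
    (Y Z : Module.End K M) (c : ℕ → ℕ) (a : ℕ) (j : ℕ) (w : M) :
    (Fin a → M) ⧸ LinearMap.range (staircaseMap Y Z c a) :=
  Submodule.Quotient.mk fun k : Fin a => if (k : ℕ) = j then w else 0

section Staircase

variable {K M : Type*} [Field K] [AddCommGroup M] [Module K M]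
  (Y Z : Module.End K M) (c : ℕ → ℕ) (a : ℕ)

theorem staircaseClass_zero (w : M) : staircaseClass Y Z c a 0 (Y w) = 0 := by
  rw [staircaseClass, Submodule.Quotient.mk_eq_zero]
  refine ⟨fun k => if (k : ℕ) = 0 then w else 0, ?_⟩
  ext k
  rw [staircaseMap_apply]
  by_cases h : (k : ℕ) = 0 <;> simp [h]

theorem staircaseClass_succ (j : ℕ) (w : M) :
    staircaseClass Y Z c a (j + 1) (Y w) =
      staircaseClass Y Z c a j ((Z ^ (c j - c (j + 1))) w) := by
  rw [staircaseClass, staircaseClass, Submodule.Quotient.eq]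
  refine ⟨fun k => if (k : ℕ) = j + 1 then w else 0, ?_⟩
  ext k
  rw [staircaseMap_apply]
  by_cases h : (k : ℕ) = j
  · simp [h]
  · by_cases h' : (k : ℕ) = j + 1 <;> simp [h, h']

theorem staircaseClass_of_le {j : ℕ} (hj : a ≤ j) (w : M) : staircaseClass Y Z c a j w = 0 := by
  rw [staircaseClass, Submodule.Quotient.mk_eq_zero]
  convert Submodule.zero_mem _ with k
  have := k.2
  simp [show (k : ℕ) ≠ j by omega]

/-- Splitting off `Z ^ (c j - c (j + 1))` moves the class to index `j + 1` with `w` replaced by `Y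
w`, leaving `Z ^ c (j + 1)`. Repeating this pushes the class off the end at index `a`. -/
theorem staircaseClass_pow_eq_zero (hYZ : Commute Y Z) (hc : Antitone c) :
    ∀ (i j : ℕ), i + j = a → ∀ w : M, staircaseClass Y Z c a j ((Z ^ c j) w) = 0 := by
  intro i
  induction i with
  | zero => intro j hj w; exact staircaseClass_of_le _ _ _ _ (by omega) _
  | succ i ih =>
    intro j hj w
    have h1 : Z ^ c j = Z ^ (c j - c (j + 1)) * Z ^ c (j + 1) := by
      rw [← pow_add, Nat.sub_add_cancel (hc (Nat.le_succ j))]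
    rw [h1, Module.End.mul_apply, ← staircaseClass_succ,
      ← Module.End.mul_apply, (hYZ.pow_right _).eq, Module.End.mul_apply]
    exact ih (j + 1) (by omega) _

/-- Each factor `Y` lowers the index by one at the price of a power of `Z`, and dies at index `0`.
Once no `Y` is left, the powers `Z ^ t` with `t ≥ c j` vanish. -/
theorem staircaseClass_mem_span (hYZ : Commute Y Z) (hc : Antitone c) {p : ℕ}
    (v : Fin p → M) (l : Fin p) : ∀ (j s t : ℕ), j < a →
      staircaseClass Y Z c a j ((Y ^ s) ((Z ^ t) (v l))) ∈ Submodule.span K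
        (Set.range fun q : (Σ j : Fin a, Fin (c j)) × Fin p =>
          staircaseClass Y Z c a q.1.1 ((Z ^ (q.1.2 : ℕ)) (v q.2))) := by
  have base : ∀ j t : ℕ, j < a → staircaseClass Y Z c a j ((Z ^ t) (v l)) ∈ Submodule.span K
        (Set.range fun q : (Σ j : Fin a, Fin (c j)) × Fin p =>
          staircaseClass Y Z c a q.1.1 ((Z ^ (q.1.2 : ℕ)) (v q.2))) := by
    intro j t hj
    by_cases ht : t < c j
    · exact Submodule.subset_span ⟨(⟨⟨j, hj⟩, ⟨t, ht⟩⟩, l), rfl⟩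
    · rw [← Nat.add_sub_cancel' (not_lt.1 ht), pow_add, Module.End.mul_apply,
        staircaseClass_pow_eq_zero Y Z c a hYZ hc (a - j) j (by omega)]
      exact Submodule.zero_mem _
  intro j
  induction j with
  | zero =>
    intro s t hj
    cases s with
    | zero => exact base 0 t hj
    | succ s =>
      rw [pow_succ', Module.End.mul_apply, staircaseClass_zero]
      exact Submodule.zero_mem _
  | succ j ih =>
    intro s t hj
    cases s with
    | zero => exact base (j + 1) t hj
    | succ s =>
      rw [pow_succ', Module.End.mul_apply, staircaseClass_succ,
        ← Module.End.mul_apply, ((hYZ.pow_pow s _).symm).eq, Module.End.mul_apply,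
        ← Module.End.mul_apply (Z ^ _), ← pow_add]
      exact ih s _ (by omega)

theorem finrank_ker_staircaseMap_le [Module.Finite K M] (hYZ : Commute Y Z) (hc : Antitone c)
    {p : ℕ} (v : Fin p → M)
    (hv : ∀ w : M, w ∈ Submodule.span K
      (Set.range fun q : ℕ × ℕ × Fin p => (Y ^ q.1) ((Z ^ q.2.1) (v q.2.2)))) :
    Module.finrank K (LinearMap.ker (staircaseMap Y Z c a)) ≤
      Module.finrank K M + p * ∑ j : Fin a, c j := by
  set D := staircaseMap Y Z c a
  have hspan : (⊤ : Submodule K ((Fin a → M) ⧸ LinearMap.range D)) ≤ Submodule.span K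
        (Set.range fun q : (Σ j : Fin a, Fin (c j)) × Fin p =>
          staircaseClass Y Z c a q.1.1 ((Z ^ (q.1.2 : ℕ)) (v q.2))) := by
    have key : ∀ (j : Fin a) (w : M), staircaseClass Y Z c a j w ∈ Submodule.span K
        (Set.range fun q : (Σ j : Fin a, Fin (c j)) × Fin p =>
          staircaseClass Y Z c a q.1.1 ((Z ^ (q.1.2 : ℕ)) (v q.2))) := by
      intro j w
      have e : ∀ w, staircaseClass Y Z c a j w =
          (LinearMap.range D).mkQ (LinearMap.single K (fun _ => M) j w) := by
        intro w
        rw [staircaseClass, Submodule.mkQ_apply]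
        congr 1
        ext k
        simp [Pi.single_apply, Fin.ext_iff]
      induction hv w using Submodule.span_induction with
      | mem x h =>
        obtain ⟨q, rfl⟩ := h
        exact staircaseClass_mem_span Y Z c a hYZ hc v _ _ _ _ j.2
      | zero => rw [e, map_zero, map_zero]; exact Submodule.zero_mem _
      | add x y _ _ hx hy =>
        rw [e, map_add, map_add, ← e, ← e]; exact Submodule.add_mem _ hx hy
      | smul k x _ hx =>
        rw [e, map_smul, map_smul, ← e]; exact Submodule.smul_mem _ _ hx
    rintro x -
    obtain ⟨n, rfl⟩ := Submodule.Quotient.mk_surjective _ x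
    have : n = ∑ j : Fin a, fun k : Fin a => if (k : ℕ) = j then n j else 0 := by
      ext k
      simp only [Finset.sum_apply, Fin.val_inj]
      simp
    rw [this, ← Submodule.mkQ_apply, map_sum]
    exact Submodule.sum_mem _ fun j _ => key j (n j)
  have h1 : Module.finrank K ((Fin a → M) ⧸ LinearMap.range D) ≤ p * ∑ j : Fin a, c j := by
    have h := finrank_range_le_card (R := K)
      (b := fun q : (Σ j : Fin a, Fin (c j)) × Fin p =>
          staircaseClass Y Z c a q.1.1 ((Z ^ (q.1.2 : ℕ)) (v q.2)))
    rw [Set.finrank, top_le_iff.1 hspan, finrank_top] at h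
    simpa [mul_comm] using h
  -- The source has one more copy of `M` than the target, so the kernel exceeds the cokernel by `dim
  -- M`.
  have h2 := D.finrank_range_add_finrank_ker
  have h3 := (LinearMap.range D).finrank_quotient_add_finrank
  simp only [Module.finrank_pi_fintype, Finset.sum_const, Finset.card_univ, Fintype.card_fin,
    smul_eq_mul] at h2 h3
  rw [add_mul, one_mul] at h2
  omega

end Staircase

open MvPolynomial

/-! ### Borel-fixed ideals are monomial -/

theorem two_three_five_pow_inj {a b c a' b' c' : ℕ}
    (h : 2 ^ a * 3 ^ b * 5 ^ c = 2 ^ a' * 3 ^ b' * 5 ^ c') : a = a' ∧ b = b' ∧ c = c' := by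
  have key : ∀ q a b c : ℕ, q.Prime → padicValNat q (2 ^ a * 3 ^ b * 5 ^ c) =
      a * padicValNat q 2 + b * padicValNat q 3 + c * padicValNat q 5 := by
    intro q a b c hq
    have := Fact.mk hq
    rw [padicValNat.mul (by positivity) (by positivity),
      padicValNat.mul (by positivity) (by positivity), padicValNat.pow,
      padicValNat.pow, padicValNat.pow]
  have e : ∀ q r : ℕ, q.Prime → r.Prime → q ≠ r → padicValNat q r = 0 := by
    intro q r hq hr hqr
    have := Fact.mk hq
    have := Fact.mk hr
    exact padicValNat_primes hqr
  have h2 := congrArg (padicValNat 2) h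
  have h3 := congrArg (padicValNat 3) h
  have h5 := congrArg (padicValNat 5) h
  have := Fact.mk Nat.prime_five
  rw [key 2 _ _ _ (by norm_num), key 2 _ _ _ (by norm_num), e 2 3 (by norm_num) (by norm_num)
    (by norm_num), e 2 5 (by norm_num) (by norm_num) (by norm_num), padicValNat_self] at h2
  rw [key 3 _ _ _ (by norm_num), key 3 _ _ _ (by norm_num), e 3 2 (by norm_num) (by norm_num)
    (by norm_num), e 3 5 (by norm_num) (by norm_num) (by norm_num), padicValNat_self] at h3
  rw [key 5 _ _ _ (by norm_num), key 5 _ _ _ (by norm_num), e 5 2 (by norm_num) (by norm_num)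
    (by norm_num), e 5 3 (by norm_num) (by norm_num) (by norm_num), padicValNat_self] at h5
  omega

/-- The ideal contains every monomial that occurs in one of its elements. -/
def IsMonomialIdeal {σ K : Type*} [Field K] (I : Ideal (MvPolynomial σ K)) : Prop :=
  ∀ f ∈ I, ∀ u ∈ f.support, monomial u 1 ∈ I

/-- A subspace stable under an operator acting on the monomials with distinct eigenvalues
contains the monomials of its elements. -/
theorem isMonomialIdeal_of_stable {σ K : Type*} [Field K] (I : Ideal (MvPolynomial σ K))
    (L : Module.End K (MvPolynomial σ K)) (μ : (σ →₀ ℕ) → K) (hμ : Function.Injective μ)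
    (hL : ∀ u, L (monomial u 1) = μ u • monomial u 1) (hI : ∀ f ∈ I, L f ∈ I) :
    IsMonomialIdeal I := by
  classical
  intro f hf u hu
  have stable : ∀ q : Polynomial K, ∀ g ∈ I, Polynomial.aeval L q g ∈ I := by
    intro q g hg
    induction q using Polynomial.induction_on' with
    | add p q hp hq => rw [map_add]; exact I.add_mem hp hq
    | monomial n a =>
      rw [Polynomial.aeval_monomial, ← Algebra.smul_def, LinearMap.smul_apply]
      refine (I.restrictScalars K).smul_mem a ?_
      induction n with
      | zero => exact hg
      | succ n ih => rw [pow_succ', Module.End.mul_apply]; exact hI _ ih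
  -- As in Lagrange interpolation, `q` kills every eigenvalue occurring in `f` except that of `u`.
  set q : Polynomial K := ∏ w ∈ f.support.erase u, (Polynomial.X - Polynomial.C (μ w))
  have hq : ∀ w, Polynomial.aeval L q (monomial w 1) = q.eval (μ w) • monomial w 1 := fun w =>
    Module.End.aeval_apply_of_hasEigenvector
      ⟨Module.End.mem_eigenspace_iff.2 (hL w), by simp⟩
  have h0 : ∀ w ∈ f.support, w ≠ u → q.eval (μ w) = 0 := by
    intro w hw hwu
    rw [Polynomial.eval_prod]
    exact Finset.prod_eq_zero (Finset.mem_erase.2 ⟨hwu, hw⟩) (by simp)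
  have h1 : q.eval (μ u) ≠ 0 := by
    rw [Polynomial.eval_prod]
    refine Finset.prod_ne_zero_iff.2 fun w hw => ?_
    simpa [sub_eq_zero] using hμ.ne (Finset.ne_of_mem_erase hw).symm
  have h2 : Polynomial.aeval L q f = (coeff u f * q.eval (μ u)) • monomial u 1 := by
    conv_lhs => rw [f.as_sum]
    rw [map_sum, Finset.sum_eq_single_of_mem u hu]
    · rw [← mul_one (coeff u f), ← smul_eq_mul, ← smul_monomial, map_smul, hq, smul_smul]
      simp
    · intro w hw hwu
      rw [← mul_one (coeff w f), ← smul_eq_mul, ← smul_monomial, map_smul, hq, h0 w hw hwu,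
        zero_smul, smul_zero]
  have h3 := stable q f hf
  rw [h2] at h3
  have h4 := (I.restrictScalars K).smul_mem (coeff u f * q.eval (μ u))⁻¹ h3
  rwa [smul_smul, inv_mul_cancel₀ (mul_ne_zero (mem_support_iff.1 hu) h1), one_smul] at h4

theorem monomial_fin_three (K : Type*) [Field K] (u : Fin 3 →₀ ℕ) :
    monomial u (1 : K) = X 0 ^ u 0 * X 1 ^ u 1 * X 2 ^ u 2 := by
  rw [monomial_eq, Finsupp.prod_fintype _ _ (by simp), Fin.prod_univ_three]
  simp

/-- The matrix `diag(2,3,5)` has eigenvalue `2^a 3^b 5^c` on `x^a y^b z^c`; in characteristic zero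
these are distinct by unique factorization. -/
theorem HilbPoints.IsBorelFixed.isMonomialIdeal {K : Type*} [Field K] [CharZero K]
    {I : Ideal (MvPolynomial (Fin 3) K)} (hB : HilbPoints.IsBorelFixed I) :
    IsMonomialIdeal I := by
  have hdet : (Matrix.diagonal (![2, 3, 5] : Fin 3 → K)).det ≠ 0 := by
    rw [Matrix.det_diagonal, Fin.prod_univ_three]
    norm_num [Matrix.cons_val_two]
  set g : GL (Fin 3) K := Matrix.GeneralLinearGroup.mkOfDetNeZero _ hdet
  have hg : (g : Matrix (Fin 3) (Fin 3) K) = Matrix.diagonal ![2, 3, 5] := rfl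
  have hX : ∀ j, HilbPoints.coordChange g (X j) = C ((![2, 3, 5] : Fin 3 → K) j) * X j := by
    intro j
    rw [HilbPoints.coordChange, aeval_X, hg, Finset.sum_eq_single j]
    · simp
    · intro i _ hij
      simp [Matrix.diagonal_apply_ne _ hij]
    · simp
  refine isMonomialIdeal_of_stable I (HilbPoints.coordChange g).toLinearMap
    (fun u => ((2 ^ u 0 * 3 ^ u 1 * 5 ^ u 2 : ℕ) : K)) ?_ ?_ ?_
  · intro u w h
    obtain ⟨h0, h1, h2⟩ := two_three_five_pow_inj (Nat.cast_injective h)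
    ext j
    fin_cases j <;> assumption
  · intro u
    rw [monomial_fin_three, AlgHom.toLinearMap_apply]
    simp only [map_mul, map_pow, hX, smul_eq_C_mul, mul_pow, Nat.cast_mul, Nat.cast_pow]
    simp
    ring
  · intro f hf
    have := Ideal.mem_map_of_mem (HilbPoints.coordChange g) hf
    rwa [hB g (by rw [hg]; exact Matrix.blockTriangular_diagonal _)] at this

/-! ### Monomial independence and finiteness -/

/-- The monomials outside an ideal of monomials are linearly independent modulo the ideal. -/
theorem IsMonomialIdeal.linearIndependent {σ K : Type*} [Field K] {I : Ideal (MvPolynomial σ K)}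
    (hI : IsMonomialIdeal I) : LinearIndependent K fun u : {u : σ →₀ ℕ // monomial u 1 ∉ I} =>
      Ideal.Quotient.mk I (monomial u.1 (1 : K)) := by
  rw [linearIndependent_iff']
  intro s a h u hu
  by_contra hne
  have h1 : ∑ w ∈ s, monomial w.1 (a w) ∈ I := by
    rw [← Ideal.Quotient.eq_zero_iff_mem, map_sum, ← h]
    refine Finset.sum_congr rfl fun w _ => ?_
    rw [← mul_one (a w), ← smul_eq_mul, ← smul_monomial, smul_eq_mul, mul_one]
    rfl
  refine u.2 (hI _ h1 _ ?_)
  classical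
  rw [mem_support_iff, coeff_sum, Finset.sum_eq_single_of_mem u hu, coeff_monomial, if_pos rfl]
  · exact hne
  · intro w _ hw
    rw [coeff_monomial, if_neg fun h => hw (Subtype.ext h)]

theorem HilbPoints.tangentSpace_finite {K : Type*} [Field K] {n : ℕ}
    (I : Ideal (MvPolynomial (Fin n) K)) [Module.Finite K (MvPolynomial (Fin n) K ⧸ I)] :
    Module.Finite K (HilbPoints.TangentSpace I) := by
  obtain ⟨s, hs⟩ := (inferInstance : Module.Finite (MvPolynomial (Fin n) K) I)
  let E : HilbPoints.TangentSpace I →ₗ[K] (s → MvPolynomial (Fin n) K ⧸ I) :=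
    { toFun := fun φ g => φ g.1
      map_add' := fun _ _ => rfl
      map_smul' := fun _ _ => rfl }
  refine Module.Finite.of_injective E fun φ ψ h => ?_
  refine LinearMap.ext_on hs fun g hg => ?_
  exact congrFun h ⟨g, hg⟩

theorem HilbPoints.finite_quotient_originIdeal_pow (K : Type*) [Field K] (n r : ℕ) :
    Module.Finite K (MvPolynomial (Fin n) K ⧸ HilbPoints.originIdeal K n ^ r) := by
  have hfin : {u : Fin n →₀ ℕ | u.degree < r}.Finite := by
    refine (Finset.finite_toSet ((Finset.range r).biUnion fun m =>
      Finset.finsuppAntidiag (Finset.univ : Finset (Fin n)) m)).subset fun u hu => ?_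
    simp only [Finset.coe_biUnion, Set.mem_iUnion]
    refine ⟨u.degree, by simpa using hu, ?_⟩
    simp [Finset.mem_finsuppAntidiag, Finsupp.degree_eq_sum]
  refine ⟨(hfin.image fun u => Ideal.Quotient.mk (HilbPoints.originIdeal K n ^ r)
    (monomial u (1 : K))).toFinset, top_le_iff.1 ?_⟩
  rintro x -
  obtain ⟨f, rfl⟩ := Ideal.Quotient.mk_surjective x
  rw [f.as_sum, map_sum]
  refine Submodule.sum_mem _ fun u _ => ?_
  by_cases hu : u.degree < r
  · have : Ideal.Quotient.mk (HilbPoints.originIdeal K n ^ r) (monomial u (coeff u f)) =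
        coeff u f • Ideal.Quotient.mk (HilbPoints.originIdeal K n ^ r) (monomial u (1 : K)) := by
      rw [← mul_one (coeff u f), ← smul_eq_mul, ← smul_monomial, smul_eq_mul, mul_one]
      rfl
    rw [this]
    refine Submodule.smul_mem _ _ (Submodule.subset_span ?_)
    simpa using ⟨u, hu, rfl⟩
  · have : monomial u (coeff u f) ∈ HilbPoints.originIdeal K n ^ r := by
      refine (mem_pow_idealOfVars_iff r _).2 fun w hw => ?_
      rw [Finset.mem_singleton.1 (support_monomial_subset hw)]
      exact not_lt.1 hu
    rw [Ideal.Quotient.eq_zero_iff_mem.2 this]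
    exact Submodule.zero_mem _

/-! ### Tangent vectors at powers of the maximal ideal -/

theorem coeff_mul_of_mem_pow_idealOfVars {σ K : Type*} [Field K] {r : ℕ} {f : MvPolynomial σ K}
    (hf : f ∈ idealOfVars σ K ^ r) (g : MvPolynomial σ K) {u : σ →₀ ℕ} (hu : u.degree = r) :
    coeff u (g * f) = coeff 0 g * coeff u f := by
  classical
  rw [coeff_mul, Finset.sum_eq_single (0, u)]
  · rintro ⟨v, w⟩ hvw hne
    rw [Finset.HasAntidiagonal.mem_antidiagonal] at hvw
    have hv : v ≠ 0 := by
      rintro rfl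
      exact hne (Prod.ext rfl (by simpa using hvw))
    have hdeg : v.degree + w.degree = r := by
      rw [← hu, ← hvw]; exact (map_add Finsupp.degree v w).symm
    have hpos : 0 < v.degree := by
      rw [Nat.pos_iff_ne_zero]
      exact fun h => hv ((Finsupp.degree_eq_zero_iff v).1 h)
    rw [(mem_pow_idealOfVars_iff' r f).1 hf w (by omega), mul_zero]
  · intro h
    exact absurd (by simp) h

/-- Forms of degree `r - 1` lie in the socle of `S/𝔪^r`. With `coeff_mul_of_mem_pow_idealOfVars`
this makes `fatPointTangent` linear over `S`. -/
theorem smul_mk_monomial {K : Type*} [Field K] {n r : ℕ} (g : MvPolynomial (Fin n) K)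
    {v : Fin n →₀ ℕ} (hv : v.degree + 1 = r) :
    g • Ideal.Quotient.mk (HilbPoints.originIdeal K n ^ r) (monomial v (1 : K)) =
      coeff 0 g • Ideal.Quotient.mk (HilbPoints.originIdeal K n ^ r) (monomial v (1 : K)) := by
  change Ideal.Quotient.mk _ (g * monomial v 1) = Ideal.Quotient.mk _ (coeff 0 g • monomial v 1)
  rw [Ideal.Quotient.eq]
  refine (mem_pow_idealOfVars_iff' r _).2 fun w hw => ?_
  classical
  rw [coeff_sub, coeff_smul, coeff_mul_monomial', coeff_monomial]
  by_cases hvw : v ≤ w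
  · obtain ⟨z, rfl⟩ := le_iff_exists_add.1 hvw
    have hdeg : (v + z).degree = v.degree + z.degree := map_add Finsupp.degree v z
    have hz : z = 0 := (Finsupp.degree_eq_zero_iff z).1 (by omega)
    subst hz
    simp
  · rw [if_neg hvw, if_neg (by rintro rfl; exact hvw le_rfl)]
    simp

theorem linearIndependent_mk_monomial (K : Type*) [Field K] (n r : ℕ) :
    LinearIndependent K fun v : {v : Fin n →₀ ℕ // v.degree + 1 = r} =>
      Ideal.Quotient.mk (HilbPoints.originIdeal K n ^ r) (monomial v.1 (1 : K)) := by
  rw [linearIndependent_iff']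
  intro s a h v hv
  have h1 : ∑ w ∈ s, a w • monomial w.1 (1 : K) ∈ HilbPoints.originIdeal K n ^ r := by
    rw [← Ideal.Quotient.eq_zero_iff_mem, map_sum, ← h]
    rfl
  have h2 := (mem_pow_idealOfVars_iff' r _).1 h1 v.1 (by have := v.2; omega)
  classical
  rw [coeff_sum, Finset.sum_eq_single_of_mem v hv] at h2
  · simpa using h2
  · intro w _ hw
    rw [coeff_smul, coeff_monomial, if_neg fun h => hw (Subtype.ext h), smul_zero]

/-- The tangent vector at `𝔪 ^ r` given by `f ↦ (coefficient of x ^ u in f) * x ^ v`. -/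
noncomputable def fatPointTangent (K : Type*) [Field K] (n r : ℕ)
    (u : {u : Fin n →₀ ℕ // u.degree = r}) (v : {v : Fin n →₀ ℕ // v.degree + 1 = r}) :
    HilbPoints.TangentSpace (HilbPoints.originIdeal K n ^ r) where
  toFun f := coeff u.1 f.1 •
    Ideal.Quotient.mk (HilbPoints.originIdeal K n ^ r) (monomial v.1 (1 : K))
  map_add' f g := by
    rw [Submodule.coe_add, coeff_add, add_smul]
  map_smul' g f := by
    rw [Submodule.coe_smul, smul_eq_mul, coeff_mul_of_mem_pow_idealOfVars f.2 g u.2, mul_comm,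
      mul_smul, RingHom.id_apply, smul_comm g, smul_mk_monomial g v.2]

theorem fatPointTangent_apply (K : Type*) [Field K] (n r : ℕ)
    (u : {u : Fin n →₀ ℕ // u.degree = r}) (v : {v : Fin n →₀ ℕ // v.degree + 1 = r})
    (f : (HilbPoints.originIdeal K n ^ r : Ideal _)) :
    fatPointTangent K n r u v f = coeff u.1 f.1 •
      Ideal.Quotient.mk (HilbPoints.originIdeal K n ^ r) (monomial v.1 (1 : K)) := rfl

/-- Exponents of degree `m` as a finite set. -/
def equivFinsuppAntidiag (n m : ℕ) : {u : Fin n →₀ ℕ // u.degree = m} ≃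
    (Finset.finsuppAntidiag (Finset.univ : Finset (Fin n)) m) :=
  Equiv.subtypeEquivRight fun u => by
    simp [Finset.mem_finsuppAntidiag, Finsupp.degree_eq_sum]

theorem linearIndependent_fatPointTangent (K : Type*) [Field K] (n r : ℕ) :
    LinearIndependent K fun q : {u : Fin n →₀ ℕ // u.degree = r} ×
      {v : Fin n →₀ ℕ // v.degree + 1 = r} => fatPointTangent K n r q.1 q.2 := by
  classical
  have hfin : ∀ m, Finite {u : Fin n →₀ ℕ // u.degree = m} := fun m =>
    Finite.of_equiv _ (equivFinsuppAntidiag n m).symm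
  have := Fintype.ofFinite {u : Fin n →₀ ℕ // u.degree = r}
  have : Fintype {v : Fin n →₀ ℕ // v.degree + 1 = r} := by
    have : Finite {v : Fin n →₀ ℕ // v.degree + 1 = r} :=
      Finite.of_injective (β := {v : Fin n →₀ ℕ // v.degree = r - 1})
        (fun v => ⟨v.1, by have := v.2; omega⟩) fun v w h => by
          simpa [Subtype.ext_iff] using h
    exact Fintype.ofFinite _
  rw [Fintype.linearIndependent_iff]
  rintro a h ⟨u, v⟩
  have hu : monomial u.1 (1 : K) ∈ HilbPoints.originIdeal K n ^ r := by
    refine (mem_pow_idealOfVars_iff r _).2 fun w hw => ?_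
    rw [Finset.mem_singleton.1 (support_monomial_subset hw), u.2]
  have h1 := LinearMap.congr_fun h ⟨_, hu⟩
  rw [Fintype.sum_prod_type, LinearMap.sum_apply, Finset.sum_eq_single u] at h1
  · rw [LinearMap.sum_apply] at h1
    refine Fintype.linearIndependent_iff.1 (linearIndependent_mk_monomial K n r)
      (fun v => a (u, v)) ?_ v
    refine Eq.trans (Finset.sum_congr rfl fun w _ => ?_) h1
    rw [LinearMap.smul_apply, fatPointTangent_apply, coeff_monomial, if_pos rfl, one_smul]
  · intro w _ hw
    rw [LinearMap.sum_apply]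
    refine Finset.sum_eq_zero fun z _ => ?_
    rw [LinearMap.smul_apply, fatPointTangent_apply, coeff_monomial, if_neg fun h => hw (Subtype.ext h).symm,
      zero_smul, smul_zero]
  · intro h
    exact absurd (Finset.mem_univ _) h

theorem natCard_degree_eq (n m : ℕ) :
    Nat.card {u : Fin n →₀ ℕ // u.degree = m} = n.multichoose m := by
  rw [Nat.card_congr (equivFinsuppAntidiag n m), Nat.card_eq_fintype_card, Fintype.card_coe,
    Finset.card_finsuppAntidiag_nat_eq_multichoose, Finset.card_univ, Fintype.card_fin]

theorem HilbPoints.le_finrank_tangentSpace_originIdeal_pow (K : Type*) [Field K] (r : ℕ) :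
    (r + 3).choose 2 * (r + 2).choose 2 ≤
      Module.finrank K (HilbPoints.TangentSpace (HilbPoints.originIdeal K 3 ^ (r + 1))) := by
  have := HilbPoints.finite_quotient_originIdeal_pow K 3 (r + 1)
  have := HilbPoints.tangentSpace_finite (HilbPoints.originIdeal K 3 ^ (r + 1))
  have h := (linearIndependent_fatPointTangent K 3 (r + 1)).cardinalMk_le_finrank
  have h' := Cardinal.toNat_le_toNat h (Cardinal.natCast_lt_aleph0)
  rw [Cardinal.toNat_natCast] at h'
  change Nat.card _ ≤ _ at h'
  simp only [Nat.card_prod, add_left_inj, natCard_degree_eq, Nat.multichoose_eq] at h'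
  convert h' using 2
  · rw [show 3 + (r + 1) - 1 = r + 3 by omega, show r + 3 = 2 + (r + 1) by omega,
      Nat.choose_symm_add]
  · rw [show 3 + r - 1 = 2 + r by omega, show r + 2 = 2 + r by omega, Nat.choose_symm_add]

/-! ### Staircase generators and the upper bound -/

theorem IsMonomialIdeal.exists_X_pow_mem {σ K : Type*} [Field K] {I : Ideal (MvPolynomial σ K)}
    (hI : IsMonomialIdeal I) [Module.Finite K (MvPolynomial σ K ⧸ I)] (j : σ) :
    ∃ b, (X j : MvPolynomial σ K) ^ b ∈ I := by
  by_contra! h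
  have := hI.linearIndependent.finite_of_isNoetherian
  refine not_injective_infinite_finite
    (fun b : ℕ => (⟨Finsupp.single j b, by rw [← X_pow_eq_monomial]; exact h b⟩ :
      {u : σ →₀ ℕ // monomial u (1 : K) ∉ I})) fun b b' hb => ?_
  exact Finsupp.single_injective j (congrArg Subtype.val hb)

/-- The least `c` such that `x ^ i * y ^ j * z ^ c ∈ I`. -/
noncomputable def stairHeight {K : Type*} [Field K] (I : Ideal (MvPolynomial (Fin 3) K))
    (i j : ℕ) : ℕ :=
  sInf {c | X 0 ^ i * X 1 ^ j * X 2 ^ c ∈ I}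

section Heights

variable {K : Type*} [Field K] {I : Ideal (MvPolynomial (Fin 3) K)}

theorem stairHeight_le {i j c : ℕ} (h : X 0 ^ i * X 1 ^ j * X 2 ^ c ∈ I) :
    stairHeight I i j ≤ c :=
  Nat.sInf_le h

theorem stairHeight_mem (hz : ∃ b, (X 2 : MvPolynomial (Fin 3) K) ^ b ∈ I) (i j : ℕ) :
    X 0 ^ i * X 1 ^ j * X 2 ^ stairHeight I i j ∈ I := by
  obtain ⟨b, hb⟩ := hz
  exact Nat.sInf_mem (s := {c | X 0 ^ i * X 1 ^ j * X 2 ^ c ∈ I}) ⟨b, I.mul_mem_left _ hb⟩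

theorem stairHeight_antitone (hz : ∃ b, (X 2 : MvPolynomial (Fin 3) K) ^ b ∈ I) (i : ℕ) :
    Antitone (stairHeight I i) := by
  refine antitone_nat_of_succ_le fun j => stairHeight_le ?_
  have h := I.mul_mem_left (X 1) (stairHeight_mem hz i j)
  convert h using 1
  ring

/-- The sum counts monomials `x^i y^j z^t` below the staircase, which are independent modulo `I`. -/
theorem sum_stairHeight_le (hI : IsMonomialIdeal I)
    [Module.Finite K (MvPolynomial (Fin 3) K ⧸ I)] (p a : ℕ) :
    ∑ i : Fin p, ∑ j : Fin a, stairHeight I i j ≤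
      Module.finrank K (MvPolynomial (Fin 3) K ⧸ I) := by
  let e : (Σ i : Fin p, Σ j : Fin a, Fin (stairHeight I i j)) →
      {u : Fin 3 →₀ ℕ // monomial u (1 : K) ∉ I} := fun q =>
    ⟨Finsupp.equivFunOnFinite.symm ![q.1, q.2.1, q.2.2], by
      rw [monomial_fin_three]
      exact Nat.notMem_of_lt_sInf q.2.2.2⟩
  have he : Function.Injective e := by
    rintro ⟨i, j, t⟩ ⟨i', j', t'⟩ h
    have h' := Finsupp.equivFunOnFinite.symm.injective (congrArg Subtype.val h)
    have h0 : i = i' := Fin.ext (congrFun h' 0)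
    have h1 : j = j' := Fin.ext (congrFun h' 1)
    subst h0 h1
    have h2 : t = t' := Fin.ext (congrFun h' 2)
    rw [h2]
  have h := (hI.linearIndependent.comp e he).fintype_card_le_finrank
  simpa using h

theorem staircase_generators (hI : IsMonomialIdeal I) {p a : ℕ}
    (ha : (X 1 : MvPolynomial (Fin 3) K) ^ a ∈ I) (N : Ideal (MvPolynomial (Fin 3) K))
    (hx : (X 0 : MvPolynomial (Fin 3) K) ^ p ∈ N)
    (hN : ∀ i < p, ∀ j ≤ a, X 0 ^ i * X 1 ^ j * X 2 ^ stairHeight I i j ∈ N) : I ≤ N := by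
  intro f hf
  rw [f.as_sum]
  refine N.sum_mem fun u hu => ?_
  rw [← mul_one (coeff u f), ← C_mul_monomial]
  refine N.mul_mem_left _ ?_
  have hu' := hI f hf u hu
  rw [monomial_fin_three] at hu' ⊢
  by_cases h0 : p ≤ u 0
  · rw [← Nat.add_sub_cancel' h0, pow_add, mul_assoc, mul_assoc]
    exact N.mul_mem_right _ hx
  have key : ∀ j ≤ a, j ≤ u 1 → stairHeight I (u 0) j ≤ u 2 →
      X 0 ^ u 0 * X 1 ^ u 1 * X 2 ^ u 2 ∈ N := by
    intro j hj hj' hc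
    have h := N.mul_mem_left (X 1 ^ (u 1 - j) * X 2 ^ (u 2 - stairHeight I (u 0) j))
      (hN (u 0) (not_le.1 h0) j hj)
    convert h using 1
    conv_lhs => rw [← Nat.add_sub_cancel' hj', ← Nat.add_sub_cancel' hc, pow_add, pow_add]
    ring
  by_cases h1 : u 1 ≤ a
  · exact key (u 1) h1 le_rfl (stairHeight_le hu')
  -- Since `y ^ a ∈ I`, the column at `j = a` has height `0`, so its generator divides the monomial.
  · refine key a le_rfl (not_le.1 h1).le ((stairHeight_le (c := 0) ?_).trans (Nat.zero_le _))
    rw [pow_zero, mul_one]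
    exact I.mul_mem_left _ ha

theorem mem_span_mulLeft_powers {p : ℕ} (hx : (X 0 : MvPolynomial (Fin 3) K) ^ p ∈ I)
    (w : MvPolynomial (Fin 3) K ⧸ I) : w ∈ Submodule.span K (Set.range fun q : ℕ × ℕ × Fin p =>
      (LinearMap.mulLeft K (Ideal.Quotient.mk I (X 1)) ^ q.1)
        ((LinearMap.mulLeft K (Ideal.Quotient.mk I (X 2)) ^ q.2.1)
          (Ideal.Quotient.mk I (X 0 ^ (q.2.2 : ℕ))))) := by
  obtain ⟨f, rfl⟩ := Ideal.Quotient.mk_surjective w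
  rw [f.as_sum, map_sum]
  refine Submodule.sum_mem _ fun u _ => ?_
  have : Ideal.Quotient.mk I (monomial u (coeff u f)) =
      coeff u f • Ideal.Quotient.mk I (monomial u (1 : K)) := by
    rw [← mul_one (coeff u f), ← smul_eq_mul, ← smul_monomial, smul_eq_mul, mul_one]
    rfl
  rw [this, monomial_fin_three]
  refine Submodule.smul_mem _ _ ?_
  by_cases h0 : u 0 < p
  · refine Submodule.subset_span ⟨(u 1, u 2, ⟨u 0, h0⟩), ?_⟩
    simp only [LinearMap.pow_mulLeft, LinearMap.mulLeft_apply, ← map_pow, ← map_mul]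
    congr 1
    ring
  · have h : X 0 ^ u 0 * X 1 ^ u 1 * X 2 ^ u 2 ∈ I := by
      rw [← Nat.add_sub_cancel' (not_lt.1 h0), pow_add, mul_assoc, mul_assoc]
      exact I.mul_mem_right _ hx
    rw [Ideal.Quotient.eq_zero_iff_mem.2 h]
    exact Submodule.zero_mem _

/-- The values of a tangent vector on the generators `x ^ i * y ^ j * z ^ stairHeight I i j`. -/
noncomputable def tangentValues (hz : ∃ b, (X 2 : MvPolynomial (Fin 3) K) ^ b ∈ I) (a i : ℕ) :
    HilbPoints.TangentSpace I →ₗ[K] LinearMap.ker (staircaseMap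
      (LinearMap.mulLeft K (Ideal.Quotient.mk I (X 1)))
      (LinearMap.mulLeft K (Ideal.Quotient.mk I (X 2))) (stairHeight I i) a) where
  toFun φ := ⟨fun j => φ ⟨_, stairHeight_mem hz i j⟩, by
    rw [LinearMap.mem_ker]
    ext j
    rw [staircaseMap_apply, LinearMap.pow_mulLeft, LinearMap.mulLeft_apply,
      LinearMap.mulLeft_apply, Pi.zero_apply, sub_eq_zero, ← map_pow]
    change (X 1 : MvPolynomial (Fin 3) K) • φ _ = (X 2 ^ _ : MvPolynomial (Fin 3) K) • φ _
    rw [← map_smul, ← map_smul]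
    congr 1
    ext1
    -- The syzygy between neighbouring generators: both multiples equal `x^i y^{j+1} z^{c_j}`.
    have h := Nat.sub_add_cancel (stairHeight_antitone hz i (Nat.le_succ j))
    simp only [Submodule.coe_smul, smul_eq_mul, Fin.val_castSucc, Fin.val_succ]
    conv_lhs => rw [← h, pow_add]
    simp only [Nat.succ_eq_add_one]
    ring⟩
  map_add' _ _ := rfl
  map_smul' _ _ := rfl

/-- The tangent space at a monomial ideal of finite colength `d` containing `x ^ p` has dimension
at most `(2 * p + 1) * d`. -/
theorem finrank_tangentSpace_le (hI : IsMonomialIdeal I)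
    [Module.Finite K (MvPolynomial (Fin 3) K ⧸ I)] {p : ℕ}
    (hx : (X 0 : MvPolynomial (Fin 3) K) ^ p ∈ I) :
    Module.finrank K (HilbPoints.TangentSpace I) ≤
      (2 * p + 1) * Module.finrank K (MvPolynomial (Fin 3) K ⧸ I) := by
  obtain ⟨a, ha⟩ := hI.exists_X_pow_mem 1
  have hz := hI.exists_X_pow_mem 2
  let ev : HilbPoints.TangentSpace I →ₗ[K] MvPolynomial (Fin 3) K ⧸ I :=
    { toFun := fun φ => φ ⟨_, hx⟩
      map_add' := fun _ _ => rfl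
      map_smul' := fun _ _ => rfl }
  let E := (LinearMap.pi fun i : Fin p => tangentValues hz a i).prod ev
  have hE : Function.Injective E := by
    rw [← LinearMap.ker_eq_bot, LinearMap.ker_eq_bot']
    intro φ hφ
    have h1 : φ ⟨_, hx⟩ = 0 := congrArg Prod.snd hφ
    have h2 : ∀ i < p, ∀ j ≤ a, φ ⟨_, stairHeight_mem hz i j⟩ = 0 := by
      intro i hi j hj
      have h := congrFun (congrArg Prod.fst hφ) ⟨i, hi⟩
      exact congrFun (congrArg Subtype.val h) ⟨j, Nat.lt_succ_of_le hj⟩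
    -- The kernel of `φ`, viewed as an ideal of `S`, contains all the generators, hence `I`.
    have hle := staircase_generators hI ha ((LinearMap.ker φ).map I.subtype)
      ⟨⟨_, hx⟩, h1, rfl⟩ fun i hi j hj => ⟨⟨_, stairHeight_mem hz i j⟩, h2 i hi j hj, rfl⟩
    ext f
    obtain ⟨g, hg, hgf⟩ := hle f.2
    rw [← Subtype.ext hgf]
    exact hg
  have h := LinearMap.finrank_le_finrank_of_injective hE
  rw [Module.finrank_prod, Module.finrank_pi_fintype] at h
  have hker : ∀ i : Fin p, _ := fun i => finrank_ker_staircaseMap_le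
    (LinearMap.mulLeft K (Ideal.Quotient.mk I (X 1)))
    (LinearMap.mulLeft K (Ideal.Quotient.mk I (X 2))) (stairHeight I i) a
    (LinearMap.ext fun w =>
      mul_left_comm (Ideal.Quotient.mk I (X 1)) (Ideal.Quotient.mk I (X 2)) w) (stairHeight_antitone hz i)
    (fun l : Fin p => Ideal.Quotient.mk I (X 0 ^ (l : ℕ))) (mem_span_mulLeft_powers hx)
  have hsum := Finset.sum_le_sum fun (i : Fin p) (_ : i ∈ Finset.univ) => hker i
  rw [Finset.sum_add_distrib, Finset.sum_const, Finset.card_univ, Fintype.card_fin, smul_eq_mul,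
    ← Finset.mul_sum] at hsum
  have hd := Nat.mul_le_mul_left p (sum_stairHeight_le hI p a)
  linarith

end Heights

/-! ### Comparison of the two bounds -/

theorem mainTheorem10 {K : Type*} [Field K] [CharZero K] (d r p : ℕ)
    (I : Ideal (MvPolynomial (Fin 3) K))
    (hI : HilbPoints.IsHilbPoint d I) (hB : HilbPoints.IsBorelFixed I)
    (hd : d ≤ (r + 2).choose 3)
    (hx : (MvPolynomial.X 0 : MvPolynomial (Fin 3) K) ^ p ∈ I)
    (hp : (p : ℚ) ≤ (3 * (r : ℚ) + 1) / 4) :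
    Module.Finite K (HilbPoints.TangentSpace I) ∧
    Module.Finite K (HilbPoints.TangentSpace (HilbPoints.originIdeal K 3 ^ r)) ∧
    Module.finrank K (HilbPoints.TangentSpace I) ≤
      Module.finrank K (HilbPoints.TangentSpace (HilbPoints.originIdeal K 3 ^ r)) := by
  obtain ⟨hfin, rfl⟩ := hI
  have := HilbPoints.finite_quotient_originIdeal_pow K 3 r
  refine ⟨HilbPoints.tangentSpace_finite I, HilbPoints.tangentSpace_finite _, ?_⟩
  refine (finrank_tangentSpace_le hB.isMonomialIdeal hx).trans ?_
  rw [le_div_iff₀ (by norm_num)] at hp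
  have hp' : p * 4 ≤ 3 * r + 1 := by exact_mod_cast hp
  cases r with
  | zero =>
    rw [show Nat.choose (0 + 2) 3 = 0 from rfl, Nat.le_zero] at hd
    rw [hd, mul_zero]
    exact Nat.zero_le _
  | succ r =>
    refine le_trans ?_ (HilbPoints.le_finrank_tangentSpace_originIdeal_pow K r)
    have h3 : (r + 3).choose 3 * 3 = (r + 3) * (r + 2).choose 2 := by
      rw [← Nat.add_one_mul_choose_eq]
    have h2 : (r + 3).choose 2 * 2 = (r + 3) * (r + 2) := by
      rw [← Nat.add_one_mul_choose_eq, Nat.choose_one_right]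
    -- With `r + 1` in place of `r`, this is `4p ≤ 3(r+1) + 1`; the ratio of the lower bound to
    -- `C(r+3,3)` is `3(r+2)/2`.
    have h4 : 2 * (2 * p + 1) ≤ 3 * (r + 2) := by omega
    have h5 : 6 * ((2 * p + 1) * (r + 3).choose 3) ≤
        6 * ((r + 3).choose 2 * (r + 2).choose 2) := by
      calc 6 * ((2 * p + 1) * (r + 3).choose 3)
          = (2 * (2 * p + 1)) * ((r + 3).choose 3 * 3) := by ring
        _ ≤ (3 * (r + 2)) * ((r + 3).choose 3 * 3) := Nat.mul_le_mul_right _ h4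
        _ = 3 * ((r + 3) * (r + 2)) * (r + 2).choose 2 := by rw [h3]; ring
        _ = 6 * ((r + 3).choose 2 * (r + 2).choose 2) := by rw [← h2]; ring
    exact (Nat.mul_le_mul_left _ hd).trans (Nat.le_of_mul_le_mul_left h5 (by norm_num))
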